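/- Let $\mathbb{F}_q$ be a finite field, $A=\mathbb{F}_q[T]$, $F=\mathbb{F}_q(T)$, and let $K=F_\infty$ be the completion of $F$ at the place $\infty=1/T$, with ring of integers $\mathcal{O}$ and residue field $k$. Let $D$ be a quaternion division algebra over $F$ (a central division algebra of dimension $4$) which is split at $\infty$, and fix an isomorphism of $K$-algebras $D\otimes_F K\cong \mathbb{M}_2(K)$. Let $\Lambda$ be a maximal $A$-order in $D$, and let $\Gamma=\Lambda^\times$ be its group of units, regarded as a subgroup of $\mathrm{GL}_2(K)$ via $\Lambda^\times\hookrightarrow D^\times\hookrightarrow (D\otimes_F K)^\times\cong \mathrm{GL}_2(K)$. Let $\mathcal{T}$ be the Bruhat–Tits tree of $\mathrm{PGL}_2(K)$: its vertices are the classes $[L]$ of lattices $L\subset K^2$ (finitely generated $\mathcal{O}$-submodules spanning $K^2$ over $K$) modulo $L\sim xL$, $x\in K^\times$; two vertices are adjacent if they have representatives $L'\subset L$ with $L/L'\cong k$; its oriented edges are the ordered pairs of adjacent vertices, the inverse of an edge $(v,w)$ being $(w,v)$. The group $\mathrm{GL}_2(K)$ acts on $\mathcal{T}$ by $g[L]=[gL]$.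 **Proposition.** The group $\Gamma$ acts on $\mathcal{T}$ without inversion (no $\gamma\in\Gamma$ maps an edge to its inverse), and the quotient graph $\Gamma\backslash\mathcal{T}$, whose vertices and edges are the $\Gamma$-orbits of the vertices and of the edges of $\mathcal{T}$, is finite, i.e., it has finitely many vertices and finitely many edges. -/

import Mathlib

open scoped Pointwise TensorProduct Polynomial

universe u v w

/-! ### Oriented graphs, group actions on them, quotient graphs -/

/-- An (oriented) graph in the sense of Serre: a nonempty set of vertices, a set of oriented edges,
origin and terminus maps, and a fixed-point-free involution `y ↦ ȳ` on the edges which exchanges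
origin and terminus. Loops and multiple edges are allowed. -/
structure SerreGraph where
  /-- vertices -/
  Ver : Type u
  /-- oriented edges -/
  Ed : Type u
  nonempty_ver : Nonempty Ver
  /-- the origin of an edge -/
  o : Ed → Ver
  /-- the terminus of an edge -/
  t : Ed → Ver
  /-- the inverse of an edge -/
  bar : Ed → Ed
  bar_bar : ∀ y, bar (bar y) = y
  bar_ne : ∀ y, bar y ≠ y
  o_eq_t_bar : ∀ y, o y = t (bar y)

namespace SerreGraph

/-- A graph is finite if it has finitely many vertices and finitely many edges. -/
def IsFinite (G : SerreGraph.{u}) : Prop :=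
  Finite G.Ver ∧ Finite G.Ed

/-- An action of a group on a graph by graph automorphisms. -/
class Action (Γ : Type w) [Group Γ] (G : SerreGraph.{u}) where
  [actVer : MulAction Γ G.Ver]
  [actEd : MulAction Γ G.Ed]
  smul_o : ∀ (g : Γ) (y : G.Ed), g • G.o y = G.o (g • y)
  smul_bar : ∀ (g : Γ) (y : G.Ed), G.bar (g • y) = g • G.bar y

attribute [reducible, instance] Action.actVer Action.actEd

/-- A subgroup of a group acting on a graph acts on that graph. -/
instance Action.ofSubgroup {Γ : Type w} [Group Γ] (G : SerreGraph.{u}) [Action Γ G]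
    (H : Subgroup Γ) : Action H G where
  smul_o g y := Action.smul_o (g : Γ) y
  smul_bar g y := Action.smul_bar (g : Γ) y

/-- No element of the group maps an edge to its inverse. -/
def ActsWithoutInversion (Γ : Type w) [Group Γ] (G : SerreGraph.{u}) [Action Γ G] : Prop :=
  ∀ (g : Γ) (y : G.Ed), g • y ≠ G.bar y

theorem Action.smul_t {Γ : Type w} [Group Γ] {G : SerreGraph.{u}} [Action Γ G]
    (g : Γ) (y : G.Ed) : g • G.t y = G.t (g • y) := by
  have h := Action.smul_o g (G.bar y)
  rwa [G.o_eq_t_bar, G.o_eq_t_bar, G.bar_bar, ← Action.smul_bar, G.bar_bar] at h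

/-- The quotient `Γ \ G` of a graph by a group acting without inversion: its vertices and edges are
the `Γ`-orbits of vertices and of edges of `G`. -/
def quotient (Γ : Type w) [Group Γ] (G : SerreGraph.{u}) [Action Γ G]
    (h : ActsWithoutInversion Γ G) : SerreGraph.{u} where
  Ver := MulAction.orbitRel.Quotient Γ G.Ver
  Ed := MulAction.orbitRel.Quotient Γ G.Ed
  nonempty_ver := G.nonempty_ver.map (Quotient.mk _)
  o := Quotient.map G.o (by
    rintro _ b ⟨g, rfl⟩
    exact ⟨g, Action.smul_o g b⟩)
  t := Quotient.map G.t (by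
    rintro _ b ⟨g, rfl⟩
    exact ⟨g, Action.smul_t g b⟩)
  bar := Quotient.map G.bar (by
    rintro _ b ⟨g, rfl⟩
    exact ⟨g, (Action.smul_bar g b).symm⟩)
  bar_bar := by
    rintro ⟨y⟩
    exact congrArg (Quotient.mk _) (G.bar_bar y)
  bar_ne := by
    rintro ⟨y⟩ hy
    obtain ⟨g, hg⟩ := Quotient.exact hy
    exact h g y hg
  o_eq_t_bar := by
    rintro ⟨y⟩
    exact congrArg (Quotient.mk _) (G.o_eq_t_bar y)

end SerreGraph

/-! ### The Bruhat-Tits tree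

Here `O` is the ring of integers of a discretely valued field `K`, and `V` is a two-dimensional
`K`-vector space. -/

namespace BruhatTits

section

variable (O : Type u) (K : Type v) (V : Type w) [CommRing O] [Field K]
  [Algebra O K] [AddCommGroup V] [Module K V] [Module O V] [IsScalarTower O K V]

/-- The lattices of `V`: the finitely generated `O`-submodules which span `V` over `K`. -/
abbrev Lattice : Type w := {L : Submodule O V // Submodule.IsLattice K L}

/-- Two lattices are equivalent if `L' = x L` for some `x ∈ Kˣ`. -/
instance homothetySetoid : Setoid (Lattice O K V) where
  r L L' := ∃ x : Kˣ, L'.1 = x • L.1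
  iseqv :=
    { refl := fun L => ⟨1, (one_smul _ _).symm⟩
      symm := by
        rintro L L' ⟨x, hx⟩
        exact ⟨x⁻¹, by rw [hx, inv_smul_smul]⟩
      trans := by
        rintro L L' L'' ⟨x, hx⟩ ⟨y, hy⟩
        exact ⟨y * x, by rw [hy, hx, mul_smul]⟩ }

/-- The vertices of the Bruhat-Tits tree: equivalence classes `[L]` of lattices. -/
def Vertex : Type w := Quotient (homothetySetoid O K V)

variable {O K V}

/-- The class of a lattice. -/
def Vertex.mk (L : Lattice O K V) : Vertex O K V := Quotient.mk _ L

/-- The natural action of `GL(V)` on lattices. -/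
instance : MulAction (LinearMap.GeneralLinearGroup K V) (Lattice O K V) where
  smul g L := ⟨g • L.1,
    { fg := by
        have := L.2.fg
        exact this.map _
      span_eq_top := by
        have h : Submodule.span K ((g • L.1 : Submodule O V) : Set V)
            = (Submodule.span K (L.1 : Set V)).map (g : V →ₗ[K] V) := by
          rw [Submodule.map_span]; rfl
        rw [h, L.2.span_eq_top, Submodule.map_top, LinearMap.range_eq_top]
        exact (LinearMap.GeneralLinearGroup.toLinearEquiv g).surjective }⟩
  one_smul L := Subtype.ext (one_smul _ L.1)
  mul_smul g h L := Subtype.ext (mul_smul g h L.1)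

@[simp]
theorem coe_smul (g : LinearMap.GeneralLinearGroup K V) (L : Lattice O K V) :
    (g • L).1 = g • L.1 := rfl

theorem smul_equiv (g : LinearMap.GeneralLinearGroup K V) {L L' : Lattice O K V}
    (h : L ≈ L') : g • L ≈ g • L' := by
  obtain ⟨x, hx⟩ := h
  refine ⟨x, ?_⟩
  rw [coe_smul, coe_smul, hx]
  apply SetLike.coe_injective
  change g • (x • (L.1 : Set V)) = x • (g • (L.1 : Set V))
  exact smul_comm _ _ _

/-- The natural action of `GL(V)` on vertices, `g [L] = [g L]`. -/
instance : MulAction (LinearMap.GeneralLinearGroup K V) (Vertex O K V) where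
  smul g := Quotient.map (g • ·) (fun _ _ => smul_equiv g)
  one_smul := by
    rintro ⟨L⟩
    exact congrArg (Quotient.mk _) (one_smul _ L)
  mul_smul g h := by
    rintro ⟨L⟩
    exact congrArg (Quotient.mk _) (mul_smul g h L)

theorem smul_mk (g : LinearMap.GeneralLinearGroup K V) (L : Lattice O K V) :
    g • Vertex.mk L = Vertex.mk (g • L) := rfl

/-- There are representatives `L ∈ v` and `L' ∈ v'` with `L' ⊆ L` and `L / L'` isomorphic to the
residue field of `O`. -/
def Neighbour [IsLocalRing O] (v v' : Vertex O K V) : Prop :=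
  ∃ L L' : Lattice O K V, Vertex.mk L = v ∧ Vertex.mk L' = v' ∧ L'.1 ≤ L.1 ∧
    Nonempty ((L.1 ⧸ L'.1.submoduleOf L.1) ≃ₗ[O] IsLocalRing.ResidueField O)

variable (O K V)

/-- The adjacency relation on vertices. For a discrete valuation ring and `dim V = 2` the relation
`Neighbour` is already symmetric and irreflexive; `SimpleGraph.fromRel` only records this. -/
def adjGraph [IsLocalRing O] : SimpleGraph (Vertex O K V) := SimpleGraph.fromRel Neighbour

variable {O K V}

theorem Neighbour.smul [IsLocalRing O] (g : LinearMap.GeneralLinearGroup K V)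
    {v v' : Vertex O K V} (h : Neighbour v v') : Neighbour (g • v) (g • v') := by
  obtain ⟨L, L', rfl, rfl, hle, ⟨e⟩⟩ := h
  refine ⟨g • L, g • L', rfl, rfl, Submodule.map_mono hle, ⟨?_⟩⟩
  let ge : V ≃ₗ[O] V := (LinearMap.GeneralLinearGroup.toLinearEquiv g).restrictScalars O
  let gL : L.1 ≃ₗ[O] (g • L).1 := ge.submoduleMap L.1
  refine (Submodule.Quotient.equiv (L'.1.submoduleOf L.1) ((g • L').1.submoduleOf (g • L).1)
    gL ?_).symm.trans e
  ext ⟨y, hy⟩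
  constructor
  · rintro ⟨⟨z, hz⟩, hz', h⟩
    obtain rfl : ge z = y := congrArg Subtype.val h
    exact ⟨z, hz', rfl⟩
  · rintro ⟨z, hz, rfl⟩
    exact ⟨⟨z, hle hz⟩, hz, rfl⟩

theorem adjGraph_adj_smul [IsLocalRing O] (g : LinearMap.GeneralLinearGroup K V)
    {v v' : Vertex O K V} (h : (adjGraph O K V).Adj v v') :
    (adjGraph O K V).Adj (g • v) (g • v') :=
  ⟨(MulAction.injective g).ne h.1, h.2.imp (Neighbour.smul g) (Neighbour.smul g)⟩

/-- The natural action of `GL(V)` on oriented edges. -/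
instance [IsLocalRing O] : MulAction (LinearMap.GeneralLinearGroup K V) (adjGraph O K V).Dart where
  smul g y := ⟨(g • y.fst, g • y.snd), adjGraph_adj_smul g y.adj⟩
  one_smul y := SimpleGraph.Dart.ext _ _ (Prod.ext (one_smul _ y.fst) (one_smul _ y.snd))
  mul_smul g h y :=
    SimpleGraph.Dart.ext _ _ (Prod.ext (mul_smul g h y.fst) (mul_smul g h y.snd))

theorem nonempty_vertex [Module.Finite K V] : Nonempty (Vertex O K V) := by
  let b := Module.finBasis K V
  refine ⟨Vertex.mk ⟨Submodule.span O (Set.range b),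
    ⟨Submodule.fg_span (Set.finite_range b), ?_⟩⟩⟩
  rw [Submodule.span_span_of_tower, b.span_eq]

variable (O K V)

/-- The Bruhat-Tits tree: its vertices are the classes of lattices in `V`, and its oriented edges
are the ordered pairs of adjacent vertices. -/
def tree [IsLocalRing O] [Module.Finite K V] : SerreGraph.{w} where
  Ver := Vertex O K V
  Ed := (adjGraph O K V).Dart
  nonempty_ver := nonempty_vertex
  o y := y.fst
  t y := y.snd
  bar y := y.symm
  bar_bar y := y.symm_symm
  bar_ne y := y.symm_ne
  o_eq_t_bar _ := rfl

/-- `GL(V)` acts on the Bruhat-Tits tree. -/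
instance [IsLocalRing O] [Module.Finite K V] :
    SerreGraph.Action (LinearMap.GeneralLinearGroup K V) (tree O K V) where
  actVer := inferInstanceAs (MulAction _ (Vertex O K V))
  actEd := inferInstanceAs (MulAction _ (adjGraph O K V).Dart)
  smul_o _ _ := rfl
  smul_bar _ _ := rfl

end

end BruhatTits

/-! ### Maximal orders and their unit groups -/

/-- An `A`-order in a finite-dimensional `F`-algebra `D`: a subring containing `A` which is finitely
generated as an `A`-module and spans `D` over `F`. -/
def IsOrder {A : Type u} (F : Type v) {D : Type w} [CommRing A] [Field F] [Algebra A F] [Ring D]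
    [Algebra F D] [Algebra A D] [IsScalarTower A F D] (Λ : Subalgebra A D) : Prop :=
  Submodule.IsLattice F (Subalgebra.toSubmodule Λ)

/-- A maximal `A`-order: an order not properly contained in another order. -/
def IsMaximalOrder {A : Type u} (F : Type v) {D : Type w} [CommRing A] [Field F] [Algebra A F]
    [Ring D] [Algebra F D] [Algebra A D] [IsScalarTower A F D] (Λ : Subalgebra A D) : Prop :=
  Maximal (IsOrder F) Λ

namespace QuaternionTree

variable (Fq : Type u) [Field Fq] [DecidableEq (RatFunc Fq)]

/-- The completion `K = F_∞` of `F = Fq(T)` at the place `∞ = 1/T`. -/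
abbrev Kinf : Type u := RatFunc.CompletionAtInfty Fq

/-- The ring of integers of `K = F_∞`. -/
noncomputable abbrev Oinf : ValuationSubring (Kinf Fq) := (Valued.v (R := Kinf Fq)).valuationSubring

/-- The Bruhat-Tits tree of `PGL₂(F_∞)`. -/
noncomputable abbrev treeInf : SerreGraph.{u} :=
  BruhatTits.tree (Oinf Fq) (Kinf Fq) (Fin 2 → Kinf Fq)

variable {Fq} {D : Type v} [Ring D] [Algebra (RatFunc Fq) D]

/-- The embedding `D → D ⊗ F_∞ ≅ M₂(F_∞)` attached to a splitting of `D` at `∞`. -/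
noncomputable def embed
    (φ : Kinf Fq ⊗[RatFunc Fq] D ≃ₐ[Kinf Fq] Matrix (Fin 2) (Fin 2) (Kinf Fq)) :
    D →ₐ[RatFunc Fq] Matrix (Fin 2) (Fin 2) (Kinf Fq) :=
  (φ.restrictScalars (RatFunc Fq)).toAlgHom.comp
    Algebra.TensorProduct.includeRight

/-- The homomorphism `ι : Λˣ → D(F_∞)ˣ ≅ GL₂(F_∞) = GL(F_∞²)` attached to a splitting of `D`
at `∞`. -/
noncomputable def unitsHom [Algebra Fq[X] D]
    (φ : Kinf Fq ⊗[RatFunc Fq] D ≃ₐ[Kinf Fq] Matrix (Fin 2) (Fin 2) (Kinf Fq))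
    (Λ : Subalgebra Fq[X] D) :
    Λˣ →* LinearMap.GeneralLinearGroup (Kinf Fq) (Fin 2 → Kinf Fq) :=
  (Matrix.GeneralLinearGroup.toLin (n := Fin 2) (R := Kinf Fq)).toMonoidHom.comp
    (Units.map ((embed φ).toRingHom.comp Λ.val.toRingHom).toMonoidHom)

/-- The group `Γ = Λˣ` of units of `Λ`, as a subgroup of `GL₂(F_∞)`. -/
noncomputable def unitGroup [Algebra Fq[X] D]
    (φ : Kinf Fq ⊗[RatFunc Fq] D ≃ₐ[Kinf Fq] Matrix (Fin 2) (Fin 2) (Kinf Fq))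
    (Λ : Subalgebra Fq[X] D) :
    Subgroup (LinearMap.GeneralLinearGroup (Kinf Fq) (Fin 2 → Kinf Fq)) :=
  (unitsHom φ Λ).range

end QuaternionTree

/-!
Write `𝒪` for the ring of integers of `K = F_∞` and `N` for the norm of `Λ` over `A`, which is the
square of the reduced norm, that is, of the determinant in `M₂(K)` (`polyHom_norm`).

*No inversion.* A unit of `Λ` has determinant of valuation `1` (`val_det_embed_unit`). If `L'`
represents a neighbour of `[L]` with `T⁻¹ L ⊊ L' ⊊ L`, then a matrix taking `L` to `L'` has
determinant of valuation `exp (-1)`, while `g L = x L'` with `g ∈ Γ` and `x ∈ Kˣ` would give an even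
exponent (`smul_ne_of_near`). So `Γ` does not even map a vertex to an adjacent one.

*Finiteness.* After a homothety, every lattice is `L = k diag(T ^ a, T ^ b) 𝒪²` with `k ∈ GL₂(𝒪)` and
`a + b ∈ {0, -1}` (`exists_cartan`). Since `F_∞ = A + 𝔪`, where `𝔪` is the maximal ideal of `𝒪`, the
pigeonhole principle, applied to the polynomial parts of the entries, provides a nonzero `x ∈ Λ`
with `x L ⊆ T ^ c 𝒪²`, where `c` depends only on `Λ` (`exists_short_element`). This bounds the degree
of `N(x)`, and `N(x) ≠ 0` because `D` is a division algebra. As `N(x) Λ ⊆ x Λ ⊆ Λ` and `Λ / N(x) Λ` is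
finite, there are only finitely many right ideals `x Λ`, so `x = s u` with `u ∈ Λˣ` and `s` in a fixed
finite set (`exists_finite_representatives`). Hence `s u L` lies between `T ^ c 𝒪²` and a fixed multiple
of it, which leaves finitely many possibilities for `u L` (`exists_finite_vertices`). The tree is
locally finite (`finite_setOf_near`), so there are also only finitely many orbits of edges.
-/

namespace QuaternionTree

open WithZero Polynomial

/-! ### Finiteness of quotients -/

section Polynomial

variable {Fq : Type*} [Field Fq]

instance [Finite Fq] (n : ℕ) : Finite (degreeLT Fq n) :=
  Finite.of_equiv _ (degreeLTEquiv Fq n).toEquiv.symm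

theorem card_degreeLT [Finite Fq] (n : ℕ) : Nat.card (degreeLT Fq n) = Nat.card Fq ^ n := by
  rw [Nat.card_congr (degreeLTEquiv Fq n).toEquiv]
  rw [Nat.card_fun, Nat.card_fin]

theorem finite_quotient_polynomial [Finite Fq] {a : Fq[X]} (ha : a ≠ 0) :
    Finite (Fq[X] ⧸ Ideal.span {a}) := by
  refine Finite.of_injective (β := degreeLT Fq a.natDegree)
    (fun z : Fq[X] ⧸ Ideal.span {a} => ⟨Quotient.out z % a, ?_⟩) ?_
  · rw [mem_degreeLT, ← degree_eq_natDegree ha]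
    exact EuclideanDomain.mod_lt _ ha
  intro z z' h
  rw [← Quotient.out_eq z, ← Quotient.out_eq z']
  refine (Ideal.Quotient.eq (I := Ideal.span {a})).2 ?_
  rw [Ideal.mem_span_singleton]
  have h : Quotient.out z % a = Quotient.out z' % a := congrArg Subtype.val h
  generalize Quotient.out z = x at *
  generalize Quotient.out z' = y at *
  rw [← EuclideanDomain.mod_add_div x a, ← EuclideanDomain.mod_add_div y a, h]
  exact ⟨x / a - y / a, by ring⟩

end Polynomial

/-! ### The completion at infinity -/

section Completion

variable (Fq : Type*) [Field Fq] [DecidableEq (RatFunc Fq)]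

/-- The variable `T`, as an element of `F_∞`; its inverse is a uniformizer. -/
noncomputable def varT : Kinf Fq := algebraMap (RatFunc Fq) (Kinf Fq) RatFunc.X

/-- The inclusion of `A = Fq[T]` into `F_∞`. -/
noncomputable def polyHom : Fq[X] →+* Kinf Fq :=
  (algebraMap (RatFunc Fq) (Kinf Fq)).comp (algebraMap Fq[X] (RatFunc Fq))

variable {Fq}

open RatFunc.CompletionAtInfty in
theorem val_algebraMap (x : RatFunc Fq) :
    Valued.v (algebraMap (RatFunc Fq) (Kinf Fq) x) = RatFunc.inftyValuation Fq x := by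
  let := RatFunc.inftyValued Fq
  exact Valued.valuedCompletion_apply x

open RatFunc.CompletionAtInfty in
theorem denseRange_algebraMap : DenseRange (algebraMap (RatFunc Fq) (Kinf Fq)) :=
  UniformSpace.Completion.denseRange_coe (α := RatFunc Fq)

@[simp]
theorem val_varT : Valued.v (varT Fq) = exp (1 : ℤ) := by
  rw [varT, val_algebraMap, RatFunc.inftyValuation.X]

theorem varT_ne_zero : varT Fq ≠ 0 := by
  rw [← Valuation.ne_zero_iff Valued.v, val_varT]
  exact exp_ne_zero

@[simp]
theorem val_varT_zpow (n : ℤ) : Valued.v (varT Fq ^ n) = exp n := by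
  rw [map_zpow₀, val_varT, ← exp_zsmul]; simp

theorem exists_val_eq_exp {x : Kinf Fq} (hx : x ≠ 0) : ∃ n : ℤ, Valued.v x = exp n :=
  ⟨_, (exp_log ((Valuation.ne_zero_iff _).2 hx)).symm⟩

theorem polyHom_injective : Function.Injective (polyHom Fq) :=
  (algebraMap (RatFunc Fq) (Kinf Fq)).injective.comp (RatFunc.algebraMap_injective Fq)

theorem val_polyHom {p : Fq[X]} (hp : p ≠ 0) :
    Valued.v (polyHom Fq p) = exp (p.natDegree : ℤ) := by
  rw [polyHom, RingHom.comp_apply, val_algebraMap, RatFunc.inftyValuation_apply,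
    RatFunc.inftyValuation.polynomial Fq hp]

theorem val_polyHom_lt_iff {p : Fq[X]} {m : ℕ} :
    Valued.v (polyHom Fq p) < exp (m : ℤ) ↔ p ∈ degreeLT Fq m := by
  rw [mem_degreeLT]
  rcases eq_or_ne p 0 with rfl | hp
  · simp
  · rw [val_polyHom hp, exp_lt_exp, degree_eq_natDegree hp]
    norm_cast

/-- Every element of `F_∞` has a polynomial part. -/
theorem exists_val_sub_polyHom_lt_one (x : Kinf Fq) :
    ∃ p : Fq[X], Valued.v (x - polyHom Fq p) < 1 := by
  obtain ⟨y, hy⟩ : ∃ y : RatFunc Fq, Valued.v (x - algebraMap (RatFunc Fq) (Kinf Fq) y) < 1 := by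
    have hU : {z : Kinf Fq | Valued.v (x - z) < 1} ∈ nhds x := by
      rw [Valued.mem_nhds]
      refine ⟨1, fun z hz => ?_⟩
      change Valued.v (x - z) < 1
      rw [Valuation.map_sub_swap]
      exact (Valuation.restrict_lt_one_iff _).1 hz
    obtain ⟨_, ⟨y, rfl⟩, hz⟩ := (denseRange_algebraMap (Fq := Fq)).inter_nhds_nonempty hU
    exact ⟨y, hz⟩
  obtain ⟨r, s, hs, rfl⟩ := IsFractionRing.div_surjective (A := Fq[X]) y
  have hs0 : s ≠ 0 := nonZeroDivisors.ne_zero hs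
  refine ⟨r / s, ?_⟩
  have hs' : polyHom Fq s ≠ 0 := by
    rw [Ne, map_eq_zero_iff _ polyHom_injective]; exact hs0
  have key : x - polyHom Fq (r / s) = (x - algebraMap (RatFunc Fq) (Kinf Fq)
      (algebraMap Fq[X] (RatFunc Fq) r / algebraMap Fq[X] (RatFunc Fq) s)) +
      polyHom Fq (r % s) / polyHom Fq s := by
    have h := congrArg (polyHom Fq) (EuclideanDomain.div_add_mod r s)
    rw [map_add, map_mul] at h
    have h2 : algebraMap (RatFunc Fq) (Kinf Fq)
      (algebraMap Fq[X] (RatFunc Fq) r / algebraMap Fq[X] (RatFunc Fq) s) =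
        polyHom Fq r / polyHom Fq s := by
      rw [map_div₀]; rfl
    rw [h2, ← h]
    field_simp
    ring
  rw [key]
  refine Valuation.map_add_lt _ hy ?_
  rw [map_div₀, div_lt_one₀ (by simpa [zero_lt_iff] using hs'), val_polyHom hs0]
  rw [val_polyHom_lt_iff, mem_degreeLT, ← degree_eq_natDegree hs0]
  exact EuclideanDomain.mod_lt r hs0

/-- The polynomial part of an element of `F_∞` of valuation less than `exp m` has degree
less than `m`. -/
theorem exists_mem_degreeLT {x : Kinf Fq} {m : ℕ} (hx : Valued.v x < exp (m : ℤ)) :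
    ∃ p ∈ degreeLT Fq m, Valued.v (x - polyHom Fq p) < 1 := by
  obtain ⟨p, hp⟩ := exists_val_sub_polyHom_lt_one x
  refine ⟨p, ?_, hp⟩
  rw [← val_polyHom_lt_iff]
  have : polyHom Fq p = x - (x - polyHom Fq p) := by ring
  rw [this]
  refine Valuation.map_sub_lt _ hx (hp.trans_le ?_)
  rw [← exp_zero, exp_le_exp]
  positivity

theorem lt_exp_iff_le_exp {x : ℤᵐ⁰} {n : ℤ} : x < exp n ↔ x ≤ exp (n - 1) := by
  rcases eq_or_ne x 0 with rfl | hx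
  · simp
  · rw [← exp_log hx, exp_lt_exp, exp_le_exp]; omega

theorem lt_one_iff_le_exp {x : ℤᵐ⁰} : x < 1 ↔ x ≤ exp (-1 : ℤ) := by
  rw [← exp_zero, lt_exp_iff_le_exp, zero_sub]

theorem mem_Oinf {x : Kinf Fq} : x ∈ Oinf Fq ↔ Valued.v x ≤ 1 := Iff.rfl

theorem smul_Oinf_def (a : Oinf Fq) (x : Fin 2 → Kinf Fq) : a • x = (a : Kinf Fq) • x := rfl

/-- The value group of `F_∞` is infinite cyclic, so `𝒪` is a discrete valuation ring. -/
instance : IsPrincipalIdealRing (Oinf Fq) := by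
  have : Nontrivial (MonoidWithZeroHom.valueGroup
      (MonoidWithZeroHom.ofClass (Valued.v (R := Kinf Fq)))) := by
    have : (Valued.v (R := Kinf Fq)).IsNontrivial :=
      ⟨varT Fq, by simp, by rw [val_varT, ← exp_zero, Ne, exp_inj]; simp⟩
    infer_instance
  exact Valuation.valuationSubring_isPrincipalIdealRing _

/-- If `a` has valuation `exp (-m)`, the polynomial part of `T ^ (m - 1) x`, which has degree less
than `m`, determines the class of `x` modulo `a`. -/
theorem finite_quotient_Oinf [Finite Fq] {a : Oinf Fq} (ha : a ≠ 0) :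
    Finite (Oinf Fq ⧸ Ideal.span {a}) := by
  have ha' : (a : Kinf Fq) ≠ 0 := by simpa using ha
  obtain ⟨n, hn⟩ := exists_val_eq_exp ha'
  have h0 : n ≤ 0 := by
    have := mem_Oinf.1 a.2
    rwa [hn, ← exp_zero, exp_le_exp] at this
  obtain ⟨m, rfl⟩ : ∃ m : ℕ, n = -m := ⟨n.natAbs, by omega⟩
  have key : ∀ x : Oinf Fq, ∃ p : degreeLT Fq m,
      Valued.v (varT Fq ^ ((m : ℤ) - 1) * x - polyHom Fq p) < 1 := by
    intro x
    obtain ⟨p, hp, h⟩ := exists_mem_degreeLT (x := varT Fq ^ ((m : ℤ) - 1) * (x : Kinf Fq)) (m := m) (by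
      rw [map_mul, val_varT_zpow]
      refine (mul_le_of_le_one_right' (mem_Oinf.1 x.2)).trans_lt ?_
      rw [exp_lt_exp]; omega)
    exact ⟨⟨p, hp⟩, h⟩
  choose f hf using key
  refine Finite.of_injective (fun z : Oinf Fq ⧸ Ideal.span {a} => f (Quotient.out z)) ?_
  intro z z' h
  rw [← Quotient.out_eq z, ← Quotient.out_eq z']
  refine (Ideal.Quotient.eq (I := Ideal.span {a})).2 ?_
  beta_reduce at h
  generalize Quotient.out z = x at *
  generalize Quotient.out z' = y at *
  have h1 := hf x
  have h2 := hf y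
  rw [← h] at h2
  have h3 := Valuation.map_sub_lt _ h1 h2
  rw [sub_sub_sub_cancel_right, ← mul_sub, map_mul, val_varT_zpow, lt_one_iff_le_exp] at h3
  rw [Ideal.mem_span_singleton]
  have h4 : Valued.v ((x - y : Kinf Fq) / a) ≤ 1 := by
    rw [map_div₀, hn]
    rw [div_le_one₀ (by simp)]
    have := mul_le_mul_right h3 (exp (1 - (m : ℤ)))
    rw [← mul_assoc, ← exp_add, ← exp_add] at this
    rwa [show 1 - (m : ℤ) + -1 = -m by ring, show 1 - (m : ℤ) + (m - 1) = 0 by ring, exp_zero,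
      one_mul] at this
  exact ⟨⟨_, h4⟩, Subtype.ext (by simp [mul_div_cancel₀ _ ha'])⟩

end Completion

/-- There are only finitely many submodules between `a P` and `P` if `R / a R` is finite. -/
theorem finite_setOf_smul_mem_le {R V : Type*} [CommRing R] [AddCommGroup V] [Module R V]
    {P : Submodule R V} (hP : P.FG) (a : R) [Finite (R ⧸ Ideal.span {a})] :
    {Q : Submodule R V | (∀ x ∈ P, a • x ∈ Q) ∧ Q ≤ P}.Finite := by
  have : Module.Finite R P := Module.Finite.iff_fg.2 hP
  have : Finite (P ⧸ (Ideal.span {a} • ⊤ : Submodule R P)) :=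
    Submodule.finite_quotient_smul _ Module.Finite.fg_top
  refine Set.Finite.of_finite_image (f := fun Q =>
    SetLike.coe ((Q.submoduleOf P).map (Ideal.span {a} • ⊤ : Submodule R P).mkQ))
    (Set.toFinite _) ?_
  rintro Q ⟨hQ, hQP⟩ Q' ⟨hQ', hQP'⟩ h
  have h' : (Q.submoduleOf P).map (Ideal.span {a} • ⊤ : Submodule R P).mkQ =
      (Q'.submoduleOf P).map (Ideal.span {a} • ⊤ : Submodule R P).mkQ := SetLike.coe_injective h
  have key : ∀ Q : Submodule R V, (∀ x ∈ P, a • x ∈ Q) →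
      (Ideal.span {a} • ⊤ : Submodule R P) ≤ Q.submoduleOf P := by
    intro Q hQ
    rw [Submodule.ideal_span_singleton_smul]
    rintro _ ⟨x, -, rfl⟩
    exact hQ _ x.2
  have h2 := congrArg (Submodule.comap (Ideal.span {a} • ⊤ : Submodule R P).mkQ) h'
  rw [Submodule.comap_map_mkQ, Submodule.comap_map_mkQ, sup_eq_right.2 (key Q hQ),
    sup_eq_right.2 (key Q' hQ')] at h2
  ext x
  constructor
  · intro hx
    have : (⟨x, hQP hx⟩ : P) ∈ Q.submoduleOf P := hx
    rw [h2] at this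
    exact this
  · intro hx
    have : (⟨x, hQP' hx⟩ : P) ∈ Q'.submoduleOf P := hx
    rw [← h2] at this
    exact this

/-! ### Lattices spanned by the columns of a matrix -/

open Matrix

section MatLattice

variable {Fq : Type*} [Field Fq] [DecidableEq (RatFunc Fq)]

/-- The `𝒪`-submodule of `K²` spanned by the columns of a matrix. -/
noncomputable def matLattice (h : Matrix (Fin 2) (Fin 2) (Kinf Fq)) :
    Submodule (Oinf Fq) (Fin 2 → Kinf Fq) :=
  Submodule.span (Oinf Fq) (Set.range h.col)

/-- The matrix has entries in `𝒪`. -/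
def IsIntegralMatrix (m : Matrix (Fin 2) (Fin 2) (Kinf Fq)) : Prop :=
  ∀ i j, Valued.v (m i j) ≤ 1

theorem mem_matLattice {h : Matrix (Fin 2) (Fin 2) (Kinf Fq)} {x : Fin 2 → Kinf Fq} :
    x ∈ matLattice h ↔ ∃ y : Fin 2 → Kinf Fq, (∀ i, Valued.v (y i) ≤ 1) ∧ h *ᵥ y = x := by
  rw [matLattice, Submodule.mem_span_range_iff_exists_fun]
  constructor
  · rintro ⟨c, rfl⟩
    refine ⟨fun i => c i, fun i => (c i).2, ?_⟩
    ext i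
    simp [mulVec, dotProduct, smul_Oinf_def, mul_comm]
  · rintro ⟨y, hy, rfl⟩
    refine ⟨fun i => ⟨y i, hy i⟩, ?_⟩
    ext i
    simp [mulVec, dotProduct, smul_Oinf_def, mul_comm]

theorem IsIntegralMatrix.det_le {m : Matrix (Fin 2) (Fin 2) (Kinf Fq)}
    (hm : IsIntegralMatrix m) : Valued.v m.det ≤ 1 := by
  rw [det_fin_two]
  refine Valuation.map_sub_le Valued.v ?_ ?_ <;>
    exact (map_mul Valued.v _ _).trans_le (mul_le_one' (hm _ _) (hm _ _))

theorem IsIntegralMatrix.adjugate {m : Matrix (Fin 2) (Fin 2) (Kinf Fq)}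
    (hm : IsIntegralMatrix m) : IsIntegralMatrix m.adjugate := by
  intro i j
  rw [adjugate_fin_two]
  fin_cases i <;> fin_cases j <;> simp [hm _ _]

theorem IsIntegralMatrix.smul {m : Matrix (Fin 2) (Fin 2) (Kinf Fq)}
    (hm : IsIntegralMatrix m) {c : Kinf Fq} (hc : Valued.v c ≤ 1) : IsIntegralMatrix (c • m) := by
  intro i j
  rw [Matrix.smul_apply, smul_eq_mul, map_mul]
  exact mul_le_one' hc (hm i j)

theorem IsIntegralMatrix.mulVec {m : Matrix (Fin 2) (Fin 2) (Kinf Fq)}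
    (hm : IsIntegralMatrix m) {y : Fin 2 → Kinf Fq} (hy : ∀ i, Valued.v (y i) ≤ 1) (i : Fin 2) :
    Valued.v ((m *ᵥ y) i) ≤ 1 := by
  change Valued.v (∑ j, m i j * y j) ≤ 1
  refine Valuation.map_sum_le Valued.v fun j _ => ?_
  exact (map_mul Valued.v _ _).trans_le (mul_le_one' (hm i j) (hy j))

theorem isIntegralMatrix_one : IsIntegralMatrix (1 : Matrix (Fin 2) (Fin 2) (Kinf Fq)) := by
  intro i j
  rw [one_apply]
  split_ifs <;> simp

theorem matLattice_mul_le {h m : Matrix (Fin 2) (Fin 2) (Kinf Fq)} (hm : IsIntegralMatrix m) :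
    matLattice (h * m) ≤ matLattice h := by
  intro x hx
  obtain ⟨y, hy, rfl⟩ := mem_matLattice.1 hx
  exact mem_matLattice.2 ⟨m *ᵥ y, hm.mulVec hy, by rw [mulVec_mulVec]⟩

theorem matLattice_mul_eq {h m : Matrix (Fin 2) (Fin 2) (Kinf Fq)} (hm : IsIntegralMatrix m)
    (hd : Valued.v m.det = 1) : matLattice (h * m) = matLattice h := by
  refine le_antisymm (matLattice_mul_le hm) ?_
  have hd0 : m.det ≠ 0 := by
    rw [← Valuation.ne_zero_iff Valued.v, hd]; exact one_ne_zero
  have : h = h * m * (m.det⁻¹ • m.adjugate) := by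
    rw [mul_assoc, mul_smul_comm, mul_adjugate, smul_smul, inv_mul_cancel₀ hd0, one_smul, mul_one]
  conv_lhs => rw [this]
  exact matLattice_mul_le (hm.adjugate.smul (by rw [map_inv₀, hd, inv_one]))

theorem exists_integral_of_matLattice_le {h h' : Matrix (Fin 2) (Fin 2) (Kinf Fq)}
    (hle : matLattice h' ≤ matLattice h) : ∃ m, IsIntegralMatrix m ∧ h' = h * m := by
  have : ∀ j, ∃ y : Fin 2 → Kinf Fq, (∀ i, Valued.v (y i) ≤ 1) ∧ h *ᵥ y = h'.col j := fun j =>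
    mem_matLattice.1 (hle (Submodule.subset_span ⟨j, rfl⟩))
  choose y hy hy' using this
  refine ⟨Matrix.of fun i j => y j i, fun i j => hy j i, ?_⟩
  ext i j
  exact (congrFun (hy' j) i).symm

theorem val_det_eq_of_matLattice_eq {h h' : Matrix (Fin 2) (Fin 2) (Kinf Fq)}
    (heq : matLattice h = matLattice h') : Valued.v h.det = Valued.v h'.det := by
  obtain ⟨m, hm, h1⟩ := exists_integral_of_matLattice_le heq.le
  obtain ⟨m', hm', h2⟩ := exists_integral_of_matLattice_le heq.ge
  refine le_antisymm ?_ ?_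
  · rw [h1, det_mul, map_mul]
    exact mul_le_of_le_one_right' hm.det_le
  · rw [h2, det_mul, map_mul]
    exact mul_le_of_le_one_right' hm'.det_le

theorem map_matLattice (g h : Matrix (Fin 2) (Fin 2) (Kinf Fq)) :
    (matLattice h).map (g.mulVecLin.restrictScalars (Oinf Fq)) = matLattice (g * h) := by
  ext x
  simp only [Submodule.mem_map, mem_matLattice]
  constructor
  · rintro ⟨_, ⟨y, hy, rfl⟩, rfl⟩
    exact ⟨y, hy, (mulVec_mulVec ..).symm⟩
  · rintro ⟨y, hy, rfl⟩
    exact ⟨_, ⟨y, hy, rfl⟩, (mulVec_mulVec .. : g *ᵥ (h *ᵥ y) = _)⟩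

theorem smul_matLattice (x : (Kinf Fq)ˣ) (h : Matrix (Fin 2) (Fin 2) (Kinf Fq)) :
    x • matLattice h = matLattice ((x : Kinf Fq) • h) := by
  ext z
  constructor
  · rintro ⟨w, hw, rfl⟩
    obtain ⟨y, hy, rfl⟩ := mem_matLattice.1 hw
    exact mem_matLattice.2 ⟨y, hy, by rw [smul_mulVec]; rfl⟩
  · intro hz
    obtain ⟨y, hy, rfl⟩ := mem_matLattice.1 hz
    exact ⟨_, mem_matLattice.2 ⟨y, hy, rfl⟩, by rw [smul_mulVec]; rfl⟩

theorem fg_matLattice (h : Matrix (Fin 2) (Fin 2) (Kinf Fq)) : (matLattice h).FG :=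
  Submodule.fg_span (Set.finite_range _)

theorem exists_eq_matLattice (L : BruhatTits.Lattice (Oinf Fq) (Kinf Fq) (Fin 2 → Kinf Fq)) :
    ∃ h : Matrix (Fin 2) (Fin 2) (Kinf Fq), h.det ≠ 0 ∧ L.1 = matLattice h := by
  obtain ⟨L, hL⟩ := L
  let b : Module.Basis (Fin 2) (Oinf Fq) L := Module.finBasisOfFinrankEq _ _ (by
    simpa using Submodule.IsLattice.finrank_of_pi (Kinf Fq) L)
  refine ⟨Matrix.of fun i j => (b j : Fin 2 → Kinf Fq) i, ?_, ?_⟩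
  · have h1 := (b.extendOfIsLattice (Kinf Fq)).linearIndependent
    have h2 : IsUnit (Matrix.of fun i j => (b j : Fin 2 → Kinf Fq) i) := by
      rw [← linearIndependent_cols_iff_isUnit]
      have e : (Matrix.of fun i j => (b j : Fin 2 → Kinf Fq) i).col =
          b.extendOfIsLattice (Kinf Fq) := by
        ext j i
        simp [Matrix.col]
      rw [e]
      exact h1
    exact ((isUnit_iff_isUnit_det _).1 h2).ne_zero
  · have h1 := congrArg (Submodule.map L.subtype) b.span_eq
    rw [Submodule.map_span, ← Set.range_comp, Submodule.map_top, Submodule.range_subtype] at h1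
    exact h1.symm

/-- An integral matrix of determinant `δ` maps `𝒪²` onto a lattice that contains `δ 𝒪²`. -/
theorem smul_mem_matLattice {h : Matrix (Fin 2) (Fin 2) (Kinf Fq)} (hm : IsIntegralMatrix h)
    (hd : h.det ≠ 0) {a : Oinf Fq} (ha : Valued.v (a : Kinf Fq) ≤ Valued.v h.det)
    {x : Fin 2 → Kinf Fq} (hx : x ∈ matLattice 1) : a • x ∈ matLattice h := by
  obtain ⟨y, hy, rfl⟩ := mem_matLattice.1 hx
  have hv : 0 < Valued.v h.det := by simpa [zero_lt_iff] using hd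
  have hi := hm.adjugate.smul (c := (a : Kinf Fq) / h.det) (by
    rw [map_div₀]; exact (div_le_one₀ hv).2 ha)
  refine mem_matLattice.2 ⟨_, hi.mulVec hy, ?_⟩
  rw [mulVec_mulVec, mul_smul_comm, mul_adjugate, smul_smul, div_mul_cancel₀ _ hd, smul_mulVec]
  rfl

theorem matLattice_mul_congr {g h h' : Matrix (Fin 2) (Fin 2) (Kinf Fq)}
    (heq : matLattice h = matLattice h') : matLattice (g * h) = matLattice (g * h') := by
  rw [← map_matLattice, heq, map_matLattice]

/-- Elementary divisors when the upper left entry divides all others: clear its row and column. -/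
theorem exists_cartan_of_le {h : Matrix (Fin 2) (Fin 2) (Kinf Fq)} (hd : h.det ≠ 0)
    (hle : ∀ i j, Valued.v (h i j) ≤ Valued.v (h 0 0)) :
    ∃ (k : Matrix (Fin 2) (Fin 2) (Kinf Fq)) (a b : ℤ), IsIntegralMatrix k ∧
      Valued.v k.det = 1 ∧ b ≤ a ∧
      matLattice h = matLattice (k * diagonal ![varT Fq ^ a, varT Fq ^ b]) := by
  have h0 : h 0 0 ≠ 0 := by
    intro h0
    have : ∀ i j, h i j = 0 := fun i j => by simpa [h0] using hle i j
    exact hd (by simp [det_fin_two, this])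
  have hv0 : 0 < Valued.v (h 0 0) := by simpa [zero_lt_iff] using h0
  obtain ⟨a, ha⟩ := exists_val_eq_exp h0
  obtain ⟨b, hb⟩ := exists_val_eq_exp (div_ne_zero hd h0)
  have hdiv : ∀ i j, Valued.v (h i j / h 0 0) ≤ 1 := fun i j => by
    rw [map_div₀]; exact (div_le_one₀ hv0).2 (hle i j)
  have hTa : varT Fq ^ a ≠ 0 := zpow_ne_zero _ varT_ne_zero
  have hTb : varT Fq ^ b ≠ 0 := zpow_ne_zero _ varT_ne_zero
  have hu : Valued.v (h 0 0 / varT Fq ^ a) = 1 := by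
    rw [map_div₀, ha, val_varT_zpow]; exact div_self exp_ne_zero
  have hw : Valued.v (h.det / h 0 0 / varT Fq ^ b) = 1 := by
    rw [map_div₀, hb, val_varT_zpow]; exact div_self exp_ne_zero
  refine ⟨!![1, 0; h 1 0 / h 0 0, 1], a, b, ?_, by simp, ?_, ?_⟩
  · intro i j
    fin_cases i <;> fin_cases j <;> simp [-map_div₀, hdiv]
  · rw [← exp_le_exp, ← ha, ← hb]
    have : h.det / h 0 0 = h 1 1 - h 0 1 * (h 1 0 / h 0 0) := by
      rw [det_fin_two]; field_simp
    rw [this]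
    refine Valuation.map_sub_le Valued.v (hle _ _) ?_
    rw [map_mul]
    exact (mul_le_of_le_one_right' (hdiv _ _)).trans (hle _ _)
  · -- the right factor left over once the lower triangular and diagonal ones are split off
    let m : Matrix (Fin 2) (Fin 2) (Kinf Fq) :=
      !![h 0 0 / varT Fq ^ a, h 0 0 / varT Fq ^ a * (h 0 1 / h 0 0);
        0, h.det / h 0 0 / varT Fq ^ b]
    have hm : IsIntegralMatrix m := by
      intro i j
      fin_cases i <;> fin_cases j
      · exact hu.le
      · exact (map_mul Valued.v _ _).trans_le (mul_le_one' hu.le (hdiv _ _))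
      · simp [m]
      · exact hw.le
    have hmd : Valued.v m.det = 1 := by
      rw [det_fin_two]
      simp only [m, of_apply, cons_val', cons_val_zero, cons_val_one, mul_zero, sub_zero]
      rw [map_mul, hu, hw, one_mul]
    rw [← matLattice_mul_eq (h := _ * _) hm hmd]
    congr 1
    ext i j
    fin_cases i <;> fin_cases j
    · simp [m, mul_apply, vecMul, dotProduct, Fin.sum_univ_two]; field_simp
    · simp [m, mul_apply, vecMul, dotProduct, Fin.sum_univ_two]; field_simp
    · simp [m, mul_apply, vecMul, dotProduct, Fin.sum_univ_two]; field_simp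
    · simp [m, mul_apply, vecMul, dotProduct, Fin.sum_univ_two, det_fin_two]; field_simp; ring

/-- The permutation matrix that exchanges the two coordinates. -/
noncomputable def swapMatrix (Fq : Type*) [Field Fq] [DecidableEq (RatFunc Fq)] :
    Matrix (Fin 2) (Fin 2) (Kinf Fq) := !![0, 1; 1, 0]

theorem swapMatrix_mul_self : swapMatrix Fq * swapMatrix Fq = 1 := by
  ext i j
  fin_cases i <;> fin_cases j <;> simp [swapMatrix]

theorem det_swapMatrix : (swapMatrix Fq).det = -1 := by simp [swapMatrix]

theorem isIntegralMatrix_swapMatrix : IsIntegralMatrix (swapMatrix Fq) := by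
  intro i j
  fin_cases i <;> fin_cases j <;> simp [swapMatrix]

theorem IsIntegralMatrix.mul {m m' : Matrix (Fin 2) (Fin 2) (Kinf Fq)}
    (hm : IsIntegralMatrix m) (hm' : IsIntegralMatrix m') : IsIntegralMatrix (m * m') :=
  fun i j => hm.mulVec (fun l => hm' l j) i

/-- Elementary divisors: up to changes of basis over `𝒪` on both sides, an invertible matrix is
diagonal with entries `T ^ a` and `T ^ b`. -/
theorem exists_cartan {h : Matrix (Fin 2) (Fin 2) (Kinf Fq)} (hd : h.det ≠ 0) :
    ∃ (k : Matrix (Fin 2) (Fin 2) (Kinf Fq)) (a b : ℤ), IsIntegralMatrix k ∧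
      Valued.v k.det = 1 ∧ b ≤ a ∧
      matLattice h = matLattice (k * diagonal ![varT Fq ^ a, varT Fq ^ b]) := by
  obtain ⟨⟨i₀, j₀⟩, hmax⟩ := Finite.exists_max (fun p : Fin 2 × Fin 2 => Valued.v (h p.1 p.2))
  obtain ⟨P, Q, hP, hPd, hPP, hQ, hQd, hQQ, h00⟩ :
      ∃ P Q : Matrix (Fin 2) (Fin 2) (Kinf Fq), IsIntegralMatrix P ∧ Valued.v P.det = 1 ∧
        P * P = 1 ∧ IsIntegralMatrix Q ∧ Valued.v Q.det = 1 ∧ Q * Q = 1 ∧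
        ∀ i j, Valued.v ((P * h * Q) i j) ≤ Valued.v ((P * h * Q) 0 0) := by
    have hS := isIntegralMatrix_swapMatrix (Fq := Fq)
    have hSd : Valued.v (swapMatrix Fq).det = 1 := by simp [det_swapMatrix]
    have h1 := isIntegralMatrix_one (Fq := Fq)
    have h1d : Valued.v (1 : Matrix (Fin 2) (Fin 2) (Kinf Fq)).det = 1 := by simp
    have h11 : (1 : Matrix (Fin 2) (Fin 2) (Kinf Fq)) * 1 = 1 := one_mul 1
    have h2 := swapMatrix_mul_self (Fq := Fq)
    have e : ∀ i j, Valued.v (h i j) ≤ Valued.v (h i₀ j₀) := fun i j => hmax (i, j)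
    have hi : i₀ = 0 ∨ i₀ = 1 := by omega
    have hj : j₀ = 0 ∨ j₀ = 1 := by omega
    rcases hi with rfl | rfl <;> rcases hj with rfl | rfl
    · refine ⟨1, 1, h1, h1d, h11, h1, h1d, h11, fun i j => ?_⟩
      fin_cases i <;> fin_cases j <;> simp [e]
    · refine ⟨1, swapMatrix Fq, h1, h1d, h11, hS, hSd, h2, fun i j => ?_⟩
      fin_cases i <;> fin_cases j <;>
        simp [e, swapMatrix, mul_apply, Fin.sum_univ_two]
    · refine ⟨swapMatrix Fq, 1, hS, hSd, h2, h1, h1d, h11, fun i j => ?_⟩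
      fin_cases i <;> fin_cases j <;>
        simp [e, swapMatrix, mul_apply, vecMul, dotProduct, Fin.sum_univ_two]
    · refine ⟨swapMatrix Fq, swapMatrix Fq, hS, hSd, h2, hS, hSd, h2, fun i j => ?_⟩
      fin_cases i <;> fin_cases j <;>
        simp [e, swapMatrix, mul_apply, vecMul, dotProduct, Fin.sum_univ_two]
  have hne : ∀ {P : Matrix (Fin 2) (Fin 2) (Kinf Fq)}, P * P = 1 → P.det ≠ 0 := by
    intro P hP h0
    simpa [h0] using congrArg det hP
  obtain ⟨k, a, b, hk, hkd, hab, heq⟩ := exists_cartan_of_le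
    (by rw [det_mul, det_mul]; exact mul_ne_zero (mul_ne_zero (hne hPP) hd) (hne hQQ)) h00
  refine ⟨P * k, a, b, hP.mul hk, by rw [det_mul, map_mul, hPd, hkd, one_mul], hab, ?_⟩
  rw [matLattice_mul_eq hQ hQd] at heq
  rw [mul_assoc, ← matLattice_mul_congr heq, ← mul_assoc, hPP, one_mul]

end MatLattice

/-! ### Adjacent vertices of the tree -/

open BruhatTits

section Adjacent

variable {Fq : Type*} [Field Fq] [DecidableEq (RatFunc Fq)]

/-- There are representatives `L` and `L'` of the two vertices with `T⁻¹ L ⊆ L' ⊆ L`. Unlike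
`BruhatTits.Neighbour`, this relation is visibly symmetric; it holds for adjacent vertices, and
also for equal ones. -/
def Near (v w : Vertex (Oinf Fq) (Kinf Fq) (Fin 2 → Kinf Fq)) : Prop :=
  ∃ L L' : Lattice (Oinf Fq) (Kinf Fq) (Fin 2 → Kinf Fq), Vertex.mk L = v ∧ Vertex.mk L' = w ∧
    (∀ x ∈ L.1, (varT Fq)⁻¹ • x ∈ L'.1) ∧ L'.1 ≤ L.1

/-- The multiple `x L` of a lattice. -/
noncomputable def scaleLattice (x : (Kinf Fq)ˣ) (L : Lattice (Oinf Fq) (Kinf Fq) (Fin 2 → Kinf Fq)) :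
    Lattice (Oinf Fq) (Kinf Fq) (Fin 2 → Kinf Fq) :=
  ⟨x • L.1, by have := L.2; infer_instance⟩

theorem mk_scaleLattice (x : (Kinf Fq)ˣ) (L : Lattice (Oinf Fq) (Kinf Fq) (Fin 2 → Kinf Fq)) :
    Vertex.mk (scaleLattice x L) = Vertex.mk L :=
  (Quotient.sound ⟨x, rfl⟩ : Vertex.mk L = Vertex.mk (scaleLattice x L)).symm

theorem mk_eq_mk_iff {L L' : Lattice (Oinf Fq) (Kinf Fq) (Fin 2 → Kinf Fq)} :
    Vertex.mk L = Vertex.mk L' ↔ ∃ x : (Kinf Fq)ˣ, L'.1 = x • L.1 :=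
  ⟨Quotient.exact, fun h => Quotient.sound h⟩

theorem Near.symm {v w : Vertex (Oinf Fq) (Kinf Fq) (Fin 2 → Kinf Fq)} (h : Near v w) :
    Near w v := by
  obtain ⟨L, L', rfl, rfl, h1, h2⟩ := h
  refine ⟨L', scaleLattice (Units.mk0 (varT Fq)⁻¹ (inv_ne_zero varT_ne_zero)) L, rfl,
    mk_scaleLattice _ _, fun x hx => ⟨x, h2 hx, rfl⟩, ?_⟩
  rintro _ ⟨x, hx, rfl⟩
  exact h1 x hx

theorem val_inv_varT_le : Valued.v (varT Fq)⁻¹ ≤ 1 := by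
  rw [map_inv₀, val_varT, ← WithZero.exp_neg, ← WithZero.exp_zero, exp_le_exp]; omega

/-- The uniformizer `T⁻¹` of `𝒪`. -/
noncomputable def uniformizer (Fq : Type*) [Field Fq] [DecidableEq (RatFunc Fq)] : Oinf Fq :=
  ⟨(varT Fq)⁻¹, val_inv_varT_le⟩

theorem uniformizer_ne_zero : uniformizer Fq ≠ 0 := by
  intro h
  exact inv_ne_zero (varT_ne_zero (Fq := Fq)) (congrArg Subtype.val h)

theorem residue_uniformizer : IsLocalRing.residue (Oinf Fq) (uniformizer Fq) = 0 := by
  rw [IsLocalRing.residue_eq_zero_iff, IsLocalRing.mem_maximalIdeal, mem_nonunits_iff]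
  intro h
  obtain ⟨y, hy⟩ := h.exists_right_inv
  have h1 : (varT Fq)⁻¹ * y = 1 := congrArg Subtype.val hy
  have h2 : (y : Kinf Fq) = varT Fq := by
    rw [inv_mul_eq_iff_eq_mul₀ varT_ne_zero, mul_one] at h1; exact h1
  have h3 := mem_Oinf.1 y.2
  rw [h2, val_varT, ← WithZero.exp_zero, exp_le_exp] at h3
  omega

theorem Near.of_neighbour {v w : Vertex (Oinf Fq) (Kinf Fq) (Fin 2 → Kinf Fq)}
    (h : Neighbour v w) : Near v w := by
  obtain ⟨L, L', rfl, rfl, hle, ⟨e⟩⟩ := h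
  refine ⟨L, L', rfl, rfl, fun x hx => ?_, hle⟩
  have h0 : e ((L'.1.submoduleOf L.1).mkQ (uniformizer Fq • ⟨x, hx⟩)) = 0 := by
    rw [map_smul, map_smul, Algebra.smul_def, IsLocalRing.ResidueField.algebraMap_eq,
      residue_uniformizer, zero_mul]
  rw [LinearEquiv.map_eq_zero_iff, Submodule.mkQ_apply, Submodule.Quotient.mk_eq_zero] at h0
  exact h0

theorem Near.of_adj {v w : Vertex (Oinf Fq) (Kinf Fq) (Fin 2 → Kinf Fq)}
    (h : (adjGraph (Oinf Fq) (Kinf Fq) (Fin 2 → Kinf Fq)).Adj v w) : Near v w :=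
  h.2.elim Near.of_neighbour fun h' => (Near.of_neighbour h').symm

/-- Finitely many vertices have a representative in a given finite set of submodules. -/
theorem finite_setOf_mk_mem {S : Set (Submodule (Oinf Fq) (Fin 2 → Kinf Fq))} (hS : S.Finite) :
    {v : Vertex (Oinf Fq) (Kinf Fq) (Fin 2 → Kinf Fq) |
      ∃ L, Vertex.mk L = v ∧ L.1 ∈ S}.Finite := by
  refine ((hS.preimage (f := fun L : Lattice (Oinf Fq) (Kinf Fq) (Fin 2 → Kinf Fq) => L.1)
    Subtype.val_injective.injOn).image Vertex.mk).subset ?_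
  rintro _ ⟨L, rfl, hL⟩
  exact ⟨L, hL, rfl⟩

/-- The tree is locally finite. -/
theorem finite_setOf_near [Finite Fq] (v : Vertex (Oinf Fq) (Kinf Fq) (Fin 2 → Kinf Fq)) :
    {w | Near v w}.Finite := by
  obtain ⟨L, rfl⟩ : ∃ L, Vertex.mk L = v := Quotient.exists_rep v
  have := finite_quotient_Oinf (uniformizer_ne_zero (Fq := Fq))
  refine (finite_setOf_mk_mem (finite_setOf_smul_mem_le L.2.fg (uniformizer Fq))).subset ?_
  rintro w ⟨L₁, L₁', h1, rfl, h2, h3⟩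
  obtain ⟨x, hx⟩ := mk_eq_mk_iff.1 h1
  refine ⟨scaleLattice x L₁', mk_scaleLattice _ _, ?_, ?_⟩
  · rw [hx]
    rintro _ ⟨y, hy, rfl⟩
    refine ⟨(varT Fq)⁻¹ • y, h2 y hy, ?_⟩
    exact smul_comm (x : Kinf Fq) (varT Fq)⁻¹ y
  · rw [hx]
    rintro _ ⟨y, hy, rfl⟩
    exact ⟨y, h3 hy, rfl⟩

theorem finite_darts_of_fst_mem [Finite Fq]
    {S : Set (Vertex (Oinf Fq) (Kinf Fq) (Fin 2 → Kinf Fq))} (hS : S.Finite) :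
    {y : (adjGraph (Oinf Fq) (Kinf Fq) (Fin 2 → Kinf Fq)).Dart | y.fst ∈ S}.Finite := by
  refine Set.Finite.of_finite_image (f := SimpleGraph.Dart.toProd) ?_
    (fun a _ b _ h => SimpleGraph.Dart.ext _ _ h)
  refine (hS.biUnion fun v _ => (Set.finite_singleton v).prod (finite_setOf_near v)).subset ?_
  rintro _ ⟨y, hy, rfl⟩
  simp only [Set.mem_iUnion]
  exact ⟨y.fst, hy, rfl, Near.of_adj y.adj⟩

/-- A linear automorphism whose determinant is a unit of `𝒪` does not map a vertex to an adjacent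
one: if `g L` is homothetic to `L'` and `T⁻¹ L ⊆ L' ⊆ L`, then `L'` has determinant of even valuation
relative to `L`, which forces `L' = L` or `L' = T⁻¹ L`. -/
theorem smul_ne_of_near {g : LinearMap.GeneralLinearGroup (Kinf Fq) (Fin 2 → Kinf Fq)}
    {M : Matrix (Fin 2) (Fin 2) (Kinf Fq)}
    (hg : (g : (Fin 2 → Kinf Fq) →ₗ[Kinf Fq] Fin 2 → Kinf Fq) = M.mulVecLin)
    (hM : Valued.v M.det = 1) {v w : Vertex (Oinf Fq) (Kinf Fq) (Fin 2 → Kinf Fq)}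
    (hne : v ≠ w) (h : Near v w) : g • v ≠ w := by
  rintro rfl
  obtain ⟨L, L', rfl, h', h1, h2⟩ := h
  obtain ⟨m₁, hd, hL⟩ := exists_eq_matLattice L
  obtain ⟨m₂, hd', hL'⟩ := exists_eq_matLattice L'
  rw [← h'] at hne
  rw [smul_mk, eq_comm, mk_eq_mk_iff] at h'
  obtain ⟨x, hx⟩ := h'
  rw [BruhatTits.coe_smul, hL'] at hx
  have hgL : g • L.1 = matLattice (M * m₁) := by
    rw [hL, ← map_matLattice, ← hg]; rfl
  rw [hgL, smul_matLattice] at hx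
  obtain ⟨n, hn⟩ := exists_val_eq_exp x.ne_zero
  rw [hL, hL'] at h2
  obtain ⟨m, hm, hmm⟩ := exists_integral_of_matLattice_le h2
  have h1' : matLattice ((varT Fq)⁻¹ • m₁) ≤ matLattice m₂ := by
    rw [← hL', ← Units.val_mk0 (inv_ne_zero (varT_ne_zero (Fq := Fq))), ← smul_matLattice, ← hL]
    rintro _ ⟨y, hy, rfl⟩
    exact h1 y hy
  obtain ⟨m', hm', hmm'⟩ := exists_integral_of_matLattice_le h1'
  have e1 := val_det_eq_of_matLattice_eq hx
  rw [det_smul, det_mul, map_mul, map_mul, hM, one_mul, map_pow, hn, hmm, det_mul, map_mul,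
    mul_comm, Fintype.card_fin] at e1
  have e2 := congrArg Valued.v (congrArg det hmm')
  rw [det_smul, hmm, det_mul, det_mul, map_mul, map_mul, map_mul, map_pow, map_inv₀, val_varT,
    mul_assoc, mul_comm, Fintype.card_fin] at e2
  have hv : Valued.v m₁.det ≠ 0 := (Valuation.ne_zero_iff _).2 hd
  have e1' := mul_right_cancel₀ hv e1
  have e2' := mul_left_cancel₀ hv e2
  have e3 : Valued.v m'.det = exp (-2 - 2 * n) := by
    rw [e1', ← WithZero.exp_nsmul, ← WithZero.exp_neg, ← WithZero.exp_nsmul] at e2'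
    rw [sub_eq_add_neg, exp_add, WithZero.exp_neg (2 * n), eq_mul_inv_iff_mul_eq₀ exp_ne_zero,
      mul_comm]
    simpa using e2'.symm
  have b1 := hm.det_le
  have b2 := hm'.det_le
  rw [e1', ← WithZero.exp_nsmul, ← WithZero.exp_zero, exp_le_exp] at b1
  rw [e3, ← WithZero.exp_zero, exp_le_exp] at b2
  obtain rfl | rfl : n = 0 ∨ n = -1 := by
    simp only [nsmul_eq_mul, Nat.cast_ofNat] at b1
    omega
  · refine hne (mk_eq_mk_iff.2 ⟨1, ?_⟩)
    rw [one_smul, hL', hmm, matLattice_mul_eq hm (by simpa using e1'), hL]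
  · refine hne (mk_eq_mk_iff.2 ⟨Units.mk0 _ (inv_ne_zero varT_ne_zero), ?_⟩)
    rw [hL', hL, smul_matLattice, Units.val_mk0, hmm', matLattice_mul_eq hm' (by simpa using e3)]

end Adjacent

/-! ### Norms of elements of an order -/

theorem det_mulLeft_matrix {R n : Type*} [CommRing R] [Fintype n] [DecidableEq n]
    (M : Matrix n n R) :
    LinearMap.det (LinearMap.mulLeft R M) = M.det ^ Fintype.card n := by
  rw [← LinearMap.det_toMatrix (Matrix.stdBasis R n n)]
  have : LinearMap.toMatrix (Matrix.stdBasis R n n) (Matrix.stdBasis R n n)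
      (LinearMap.mulLeft R M) = kroneckerMap (fun x y => x * y) M (1 : Matrix n n R) := by
    ext ⟨i, j⟩ ⟨k, l⟩
    rw [LinearMap.toMatrix_apply, Matrix.stdBasis_eq_single, kroneckerMap_apply]
    change (M * Matrix.single k l (1 : R) : Matrix n n R) i j = _
    by_cases h : j = l
    · subst h; simp
    · simp [h, one_apply]
  rw [this, det_kronecker, det_one, one_pow, mul_one]

/-- The adjugate of `f` is an inverse of `f` up to the factor `det f`. -/
theorem det_smul_mem_range {R M : Type*} [CommRing R] [AddCommGroup M] [Module R M]
    [Module.Free R M] [Module.Finite R M] (f : M →ₗ[R] M) (y : M) :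
    LinearMap.det f • y ∈ LinearMap.range f := by
  classical
  let b := Module.Free.chooseBasis R M
  refine ⟨Matrix.toLin b b (LinearMap.toMatrix b b f).adjugate y, ?_⟩
  have h := congrArg (Matrix.toLin b b) (mul_adjugate (LinearMap.toMatrix b b f))
  rw [Matrix.toLin_mul b b b, Matrix.toLin_toMatrix, LinearMap.det_toMatrix, map_smul,
    Matrix.toLin_one] at h
  exact LinearMap.congr_fun h y

section Embed

variable {Fq : Type*} [Field Fq] [DecidableEq (RatFunc Fq)] {D : Type*} [DivisionRing D]
  [Algebra (RatFunc Fq) D]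
  (φ : Kinf Fq ⊗[RatFunc Fq] D ≃ₐ[Kinf Fq] Matrix (Fin 2) (Fin 2) (Kinf Fq))

/-- The determinant of left multiplication on `D` is the square of the reduced norm. -/
theorem algebraMap_det_mulLeft [Module.Finite (RatFunc Fq) D] (d : D) :
    algebraMap (RatFunc Fq) (Kinf Fq) (LinearMap.det (LinearMap.mulLeft (RatFunc Fq) d)) =
      (embed φ d).det ^ 2 := by
  rw [← LinearMap.det_baseChange]
  have h := det_mulLeft_matrix (embed φ d)
  rw [Fintype.card_fin] at h
  rw [← h, ← LinearMap.det_conj _ φ.toLinearEquiv]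
  congr 1
  ext1 x
  obtain ⟨x, rfl⟩ := φ.surjective x
  have : ∀ y, (LinearMap.mulLeft (RatFunc Fq) d).baseChange (Kinf Fq) y = (1 ⊗ₜ d) * y := by
    intro y
    induction y with
    | zero => simp
    | tmul a b => simp
    | add a b ha hb => rw [map_add, ha, hb, mul_add]
  simp [this, embed]

theorem det_embed_ne_zero {d : D} (hd : d ≠ 0) : (embed φ d).det ≠ 0 := by
  intro h
  have := congrArg (fun x => (embed φ x).det) (mul_inv_cancel₀ hd)
  simp [h] at this

end Embed

section Order

variable {Fq : Type*} [Field Fq] {D : Type*} [DivisionRing D] [Algebra (RatFunc Fq) D]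
  [Algebra Fq[X] D] [IsScalarTower Fq[X] (RatFunc Fq) D] {Λ : Subalgebra Fq[X] D}

theorem _root_.IsOrder.finite (hΛ : IsOrder (RatFunc Fq) Λ) : Module.Finite Fq[X] Λ :=
  Module.Finite.iff_fg.2 hΛ.fg

theorem _root_.IsOrder.free (hΛ : IsOrder (RatFunc Fq) Λ) : Module.Free Fq[X] Λ :=
  have : Submodule.IsLattice (RatFunc Fq) (Subalgebra.toSubmodule Λ) := hΛ
  (inferInstance : Module.Free Fq[X] (Subalgebra.toSubmodule Λ))

theorem _root_.IsOrder.finrank_eq (hΛ : IsOrder (RatFunc Fq) Λ) :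
    Module.finrank Fq[X] Λ = Module.finrank (RatFunc Fq) D :=
  have : Submodule.IsLattice (RatFunc Fq) (Subalgebra.toSubmodule Λ) := hΛ
  congrArg Cardinal.toNat (Submodule.IsLattice.rank' (RatFunc Fq) (Subalgebra.toSubmodule Λ))

/-- Up to right multiplication by units, an order has only finitely many elements of bounded
nonzero norm: `x Λ` contains `N(x) Λ`, which has finite index in `Λ`. -/
theorem exists_finite_representatives [Finite Fq] [Module.Finite (RatFunc Fq) D]
    (hΛ : IsOrder (RatFunc Fq) Λ) (n : ℕ) :
    ∃ S : Set Λ, S.Finite ∧ 0 ∉ S ∧ ∀ x : Λ, Algebra.norm Fq[X] x ≠ 0 →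
      Algebra.norm Fq[X] x ∈ degreeLT Fq n → ∃ s ∈ S, ∃ u : Λˣ, x = s * u := by
  have := hΛ.finite
  have := hΛ.free
  let X : Set Λ := {x | Algebra.norm Fq[X] x ≠ 0 ∧ Algebra.norm Fq[X] x ∈ degreeLT Fq n}
  let I : Λ → Submodule Fq[X] Λ := fun x => LinearMap.range (LinearMap.mulLeft Fq[X] x)
  have hfin : (I '' X).Finite := by
    have hdeg : {a : Fq[X] | a ∈ degreeLT Fq n ∧ a ≠ 0}.Finite :=
      (Set.finite_coe_iff.1 (inferInstanceAs (Finite (degreeLT Fq n)))).subset fun _ h => h.1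
    refine (hdeg.biUnion
      (t := fun a => {Q : Submodule Fq[X] Λ | (∀ y ∈ (⊤ : Submodule Fq[X] Λ), a • y ∈ Q) ∧ Q ≤ ⊤})
      fun a ha => ?_).subset ?_
    · have := finite_quotient_polynomial (Fq := Fq) ha.2
      exact finite_setOf_smul_mem_le Module.Finite.fg_top a
    · rintro _ ⟨x, hx, rfl⟩
      rw [Set.mem_iUnion₂]
      exact ⟨_, ⟨hx.2, hx.1⟩, fun y _ => det_smul_mem_range (LinearMap.mulLeft Fq[X] x) y, le_top⟩
  obtain ⟨S, hSX, hS⟩ := Set.exists_subset_bijOn X I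
  have hne : ∀ x ∈ X, x ≠ 0 := by
    rintro _ hx rfl
    exact hx.1 Algebra.norm_zero
  refine ⟨S, hS.finite_iff_finite.2 hfin, fun h => hne 0 (hSX h) rfl, fun x h1 h2 => ?_⟩
  obtain ⟨s, hs, hI⟩ := hS.surjOn ⟨x, ⟨h1, h2⟩, rfl⟩
  have hx : x ∈ I s := hI ▸ (⟨1, mul_one x⟩ : x ∈ I x)
  have hs' : s ∈ I x := hI ▸ (⟨1, mul_one s⟩ : s ∈ I s)
  obtain ⟨u, hu⟩ := hx
  obtain ⟨w, hw⟩ := hs'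
  simp only [LinearMap.mulLeft_apply] at hu hw
  have huw : u * w = 1 := mul_left_cancel₀ (hne s (hSX hs)) (by rw [← mul_assoc, hu, hw, mul_one])
  have hwu : w * u = 1 := mul_left_cancel₀ (hne x ⟨h1, h2⟩) (by rw [← mul_assoc, hw, hu, mul_one])
  exact ⟨s, hs, ⟨u, w, huw, hwu⟩, hu.symm⟩

end Order

section Norm

variable {Fq : Type*} [Field Fq] [DecidableEq (RatFunc Fq)] {D : Type*} [DivisionRing D]
  [Algebra (RatFunc Fq) D] [Algebra Fq[X] D] [IsScalarTower Fq[X] (RatFunc Fq) D]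
  (φ : Kinf Fq ⊗[RatFunc Fq] D ≃ₐ[Kinf Fq] Matrix (Fin 2) (Fin 2) (Kinf Fq))
  {Λ : Subalgebra Fq[X] D}

theorem embed_smul (p : Fq[X]) (d : D) : embed φ (p • d) = polyHom Fq p • embed φ d := by
  rw [← algebraMap_smul (RatFunc Fq) p d, map_smul, ← algebraMap_smul (Kinf Fq)]
  rfl

/-- The norm of an element of an order is the square of its reduced norm. -/
theorem polyHom_norm [Module.Finite (RatFunc Fq) D] (hΛ : IsOrder (RatFunc Fq) Λ) (x : Λ) :
    polyHom Fq (Algebra.norm Fq[X] x) = (embed φ x).det ^ 2 := by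
  classical
  have := hΛ.finite
  have := hΛ.free
  have : Submodule.IsLattice (RatFunc Fq) (Subalgebra.toSubmodule Λ) := hΛ
  rw [← algebraMap_det_mulLeft, polyHom, RingHom.comp_apply]
  congr 1
  let b : Module.Basis _ Fq[X] (Subalgebra.toSubmodule Λ) := Module.Free.chooseBasis Fq[X] Λ
  rw [Algebra.norm_eq_matrix_det (Module.Free.chooseBasis Fq[X] Λ), RingHom.map_det,
    ← LinearMap.det_toMatrix (b.extendOfIsLattice (RatFunc Fq))]
  congr 1
  ext i j
  have e : LinearMap.mulLeft (RatFunc Fq) (x : D) (b.extendOfIsLattice (RatFunc Fq) j) =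
      ∑ k, algebraMap Fq[X] (RatFunc Fq) (b.repr (x * (b j : Λ) : Λ) k) •
        b.extendOfIsLattice (RatFunc Fq) k := by
    have h := congrArg (Subalgebra.toSubmodule Λ).subtype (b.sum_repr (x * (b j : Λ) : Λ))
    rw [map_sum] at h
    simp only [Module.Basis.extendOfIsLattice_apply, algebraMap_smul, LinearMap.mulLeft_apply]
    exact h.symm
  rw [LinearMap.toMatrix_apply, e, Module.Basis.repr_sum_self]
  simp [Algebra.leftMulMatrix_eq_repr_mul, b]

theorem norm_ne_zero [Module.Finite (RatFunc Fq) D]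
    (φ : Kinf Fq ⊗[RatFunc Fq] D ≃ₐ[Kinf Fq] Matrix (Fin 2) (Fin 2) (Kinf Fq))
    (hΛ : IsOrder (RatFunc Fq) Λ) {x : Λ}
    (hx : x ≠ 0) : Algebra.norm Fq[X] x ≠ 0 := by
  intro h
  have := polyHom_norm φ hΛ x
  rw [h, map_zero, eq_comm, sq_eq_zero_iff] at this
  exact det_embed_ne_zero φ (by simpa using hx) this

/-- The square of the determinant is a nonzero polynomial. -/
theorem one_le_val_det_embed [Module.Finite (RatFunc Fq) D] (hΛ : IsOrder (RatFunc Fq) Λ) {x : Λ}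
    (hx : x ≠ 0) : 1 ≤ Valued.v (embed φ x).det := by
  have h := congrArg Valued.v (polyHom_norm φ hΛ x)
  rw [val_polyHom (norm_ne_zero φ hΛ hx), map_pow] at h
  rw [← one_le_sq_iff₀ zero_le, ← h, ← WithZero.exp_zero, exp_le_exp]
  positivity

/-- The determinants of `u` and of `u⁻¹` both have valuation at least `1`, and their product is `1`. -/
theorem val_det_embed_unit [Module.Finite (RatFunc Fq) D] (hΛ : IsOrder (RatFunc Fq) Λ) (u : Λˣ) :
    Valued.v (embed φ (u : Λ)).det = 1 := by
  refine le_antisymm ?_ (one_le_val_det_embed φ hΛ u.ne_zero)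
  have h := one_le_val_det_embed φ hΛ (u⁻¹).ne_zero
  have h2 : embed φ (u : Λ) * embed φ (u⁻¹ : Λˣ) = 1 := by
    rw [← map_mul, ← Subalgebra.coe_mul, u.mul_inv]; simp
  have h3 := congrArg (fun M => Valued.v (det M)) h2
  simp only [det_mul, map_mul, det_one, map_one] at h3
  calc _ = Valued.v (embed φ (u : Λ)).det * 1 := (mul_one _).symm
    _ ≤ Valued.v (embed φ (u : Λ)).det * Valued.v (embed φ (u⁻¹ : Λˣ)).det := by gcongr
    _ = 1 := h3

end Norm

/-! ### Short elements of an order -/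

section Minkowski

variable {Fq : Type*} [Field Fq] [DecidableEq (RatFunc Fq)] {D : Type*} [DivisionRing D]
  [Algebra (RatFunc Fq) D] [Algebra Fq[X] D] [IsScalarTower Fq[X] (RatFunc Fq) D]
  (φ : Kinf Fq ⊗[RatFunc Fq] D ≃ₐ[Kinf Fq] Matrix (Fin 2) (Fin 2) (Kinf Fq))
  {Λ : Subalgebra Fq[X] D}

/-- A Minkowski type statement: there is a constant `c` such that every lattice
`L = k diag(T ^ a, T ^ b) 𝒪²` with `a + b ≤ 0` satisfies `x L ⊆ T ^ c 𝒪²` for some nonzero `x` in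
the order. -/
theorem exists_short_element [Finite Fq] (hΛ : IsOrder (RatFunc Fq) Λ)
    (hD : Module.finrank (RatFunc Fq) D = 4) :
    ∃ c : ℕ, ∀ (k : Matrix (Fin 2) (Fin 2) (Kinf Fq)) (a b : ℤ), IsIntegralMatrix k → b ≤ a →
      a + b ≤ 0 → ∃ x : Λ, x ≠ 0 ∧ IsIntegralMatrix
        (varT Fq ^ (-c : ℤ) • (embed φ x * (k * diagonal ![varT Fq ^ a, varT Fq ^ b]))) := by
  have := hΛ.finite
  have := hΛ.free
  let e : Module.Basis (Fin 4) Fq[X] Λ := Module.finBasisOfFinrankEq _ _ (hΛ.finrank_eq.trans hD)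
  obtain ⟨c, hc⟩ : ∃ c : ℕ, ∀ l i j, Valued.v (embed φ (e l) i j) ≤ exp (c : ℤ) := by
    have h1 : ∀ q : Fin 4 × Fin 2 × Fin 2, ∃ n : ℕ,
        Valued.v (embed φ (e q.1) q.2.1 q.2.2) ≤ exp (n : ℤ) := by
      rintro ⟨l, i, j⟩
      rcases eq_or_ne (embed φ (e l) i j) 0 with h0 | h0
      · exact ⟨0, by simp [h0]⟩
      · obtain ⟨n, hn⟩ := exists_val_eq_exp h0
        exact ⟨n.toNat, by rw [hn, exp_le_exp]; omega⟩
    choose n hn using h1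
    refine ⟨Finset.univ.sup n, fun l i j => (hn (l, i, j)).trans ?_⟩
    rw [exp_le_exp]
    exact_mod_cast Finset.le_sup (f := n) (Finset.mem_univ (l, i, j))
  refine ⟨c, fun k a b hk hab hab0 => ?_⟩
  -- elements with coordinates of degree at most `-b` in the basis `e`
  obtain ⟨m, rfl⟩ : ∃ m : ℕ, b = -m := ⟨b.natAbs, by omega⟩
  obtain ⟨d, hd⟩ : ∃ d : ℕ, (d : ℤ) = a + m := ⟨(a + m).natAbs, by omega⟩
  let lift : (Fin 4 → degreeLT Fq (m + 1)) → Λ := fun p => ∑ l, (p l : Fq[X]) • e l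
  have hlift : ∀ p i j, Valued.v ((embed φ (lift p) * k) i j) ≤ exp (m + c : ℤ) := by
    intro p i j
    rw [mul_apply]
    refine Valuation.map_sum_le _ fun l _ => ?_
    rw [map_mul]
    refine (mul_le_of_le_one_right' (hk l j)).trans ?_
    have h1 : embed φ (lift p : D) = ∑ l, polyHom Fq (p l) • embed φ (e l) := by
      simp only [lift, AddSubmonoidClass.coe_finsetSum, map_sum]
      refine Finset.sum_congr rfl fun l _ => ?_
      rw [← embed_smul]; rfl
    rw [h1, Matrix.sum_apply]
    refine Valuation.map_sum_le _ fun l' _ => ?_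
    rw [Matrix.smul_apply, smul_eq_mul, map_mul, exp_add]
    refine mul_le_mul' ?_ (hc _ _ _)
    have h2 := val_polyHom_lt_iff.2 (p l').2
    rw [lt_exp_iff_le_exp] at h2
    simpa using h2
  -- the second column is small enough already; the first is controlled by polynomial parts
  have hpart : ∀ p i, ∃ r : degreeLT Fq d,
      Valued.v (varT Fq ^ (a - c - 1) * (embed φ (lift p) * k) i 0 - polyHom Fq r) < 1 := by
    intro p i
    obtain ⟨r, hr, h⟩ := exists_mem_degreeLT (m := d)
      (x := varT Fq ^ (a - c - 1) * (embed φ (lift p) * k) i 0) (by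
        rw [map_mul, val_varT_zpow]
        refine (mul_le_mul_right (hlift p i 0) _).trans_lt ?_
        rw [← exp_add, exp_lt_exp]; omega)
    exact ⟨⟨r, hr⟩, h⟩
  choose part hpart using hpart
  -- pigeonhole: `4 (m + 1) > 2 d`, because `a + b ≤ 0`
  obtain ⟨p, p', hne, heq⟩ : ∃ p p', p ≠ p' ∧ part p = part p' := by
    by_contra! hinj
    have hcard := Nat.card_le_card_of_injective part fun p p' h => by
      by_contra hpp; exact hinj p p' hpp h
    rw [Nat.card_fun, Nat.card_fun, card_degreeLT, card_degreeLT, ← pow_mul, ← pow_mul,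
      Nat.card_fin, Nat.card_fin, Nat.pow_le_pow_iff_right Finite.one_lt_card] at hcard
    omega
  refine ⟨lift p - lift p', ?_, ?_⟩
  · intro h0
    refine hne (funext fun l => Subtype.ext ?_)
    have := congrArg (fun z => e.repr z l) (sub_eq_zero.1 h0)
    simpa only [lift, Module.Basis.repr_sum_self] using this
  · have hsub : embed φ ((lift p - lift p' : Λ) : D) * k =
        embed φ (lift p) * k - embed φ (lift p') * k := by
      rw [← sub_mul, ← map_sub]; rfl
    have h0 : ∀ i, Valued.v ((embed φ ((lift p - lift p' : Λ) : D) * k) i 0) ≤ exp (c - a : ℤ) := by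
      intro i
      have h1 := hpart p i
      have h2 := hpart p' i
      rw [← heq] at h2
      have h3 := Valuation.map_sub_lt _ h1 h2
      rw [sub_sub_sub_cancel_right, ← mul_sub, map_mul, val_varT_zpow, lt_one_iff_le_exp] at h3
      have h4 := mul_le_mul_right h3 (exp (c + 1 - a : ℤ))
      rw [← mul_assoc, ← exp_add, ← exp_add, show (c + 1 - a + (a - c - 1) : ℤ) = 0 by ring,
        WithZero.exp_zero, one_mul, show (c + 1 - a + -1 : ℤ) = c - a by ring] at h4
      rw [hsub]
      exact h4
    have h1 : ∀ i, Valued.v ((embed φ ((lift p - lift p' : Λ) : D) * k) i 1) ≤ exp (m + c : ℤ) := by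
      intro i
      rw [hsub]
      exact Valuation.map_sub_le _ (hlift p i 1) (hlift p' i 1)
    intro i j
    rw [← mul_assoc, Matrix.smul_apply, mul_diagonal, smul_eq_mul, map_mul, map_mul, val_varT_zpow]
    have hj : j = 0 ∨ j = 1 := by omega
    rcases hj with rfl | rfl
    · rw [cons_val_zero, val_varT_zpow]
      refine (mul_le_mul_right (mul_le_mul_left (h0 i) _) _).trans ?_
      rw [← exp_add, ← exp_add, ← WithZero.exp_zero, exp_le_exp]; omega
    · rw [cons_val_one, cons_val_zero, val_varT_zpow]
      refine (mul_le_mul_right (mul_le_mul_left (h1 i) _) _).trans ?_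
      rw [← exp_add, ← exp_add, ← WithZero.exp_zero, exp_le_exp]; omega

/-! ### Finiteness of the quotient -/

/-- Finitely many vertices represent all orbits: a short element `x` for a lattice `L` factors as
`x = s u` with `u` a unit and `s` in a finite set, and then `s u L ⊆ T ^ c 𝒪²` has bounded index. -/
theorem exists_finite_vertices [Finite Fq] (hΛ : IsOrder (RatFunc Fq) Λ)
    (hD : Module.finrank (RatFunc Fq) D = 4) :
    ∃ R : Set (Vertex (Oinf Fq) (Kinf Fq) (Fin 2 → Kinf Fq)), R.Finite ∧
      ∀ v, ∃ g ∈ unitGroup φ Λ, g • v ∈ R := by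
  have : Module.Finite (RatFunc Fq) D := Module.finite_of_finrank_eq_succ hD
  obtain ⟨c, hc⟩ := exists_short_element φ hΛ hD
  -- `x L ⊆ T ^ c 𝒪²` bounds the exponent of `det x` by `2 c + 1`, hence `deg N(x)` by `4 c + 2`
  obtain ⟨S, hS, hS0, hS'⟩ := exists_finite_representatives hΛ (4 * c + 3)
  have hπ : uniformizer Fq ^ (2 * c + 1) ≠ 0 := pow_ne_zero _ uniformizer_ne_zero
  have := finite_quotient_Oinf hπ
  -- the candidates for `T ^ (-c) x L`
  let Q₀ := {Q : Submodule (Oinf Fq) (Fin 2 → Kinf Fq) |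
    (∀ x ∈ matLattice 1, uniformizer Fq ^ (2 * c + 1) • x ∈ Q) ∧ Q ≤ matLattice 1}
  have hQ₀ : Q₀.Finite := finite_setOf_smul_mem_le (fg_matLattice 1) _
  refine ⟨⋃ s ∈ S, {v | ∃ L, Vertex.mk L = v ∧ L.1 ∈ (fun Q => Submodule.map
    ((embed φ (s : D))⁻¹.mulVecLin.restrictScalars (Oinf Fq)) Q) '' Q₀},
    hS.biUnion fun s _ => finite_setOf_mk_mem (hQ₀.image _), fun v => ?_⟩
  obtain ⟨L, rfl⟩ : ∃ L, Vertex.mk L = v := Quotient.exists_rep v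
  obtain ⟨h, hd, hL⟩ := exists_eq_matLattice L
  obtain ⟨k, a', b', hk, hkd, hab', hh⟩ := exists_cartan hd
  -- the homothety `T ^ t` makes the exponents sum up to `0` or `-1`
  obtain ⟨t, a, b, ha, hb, hab, hab1⟩ : ∃ t a b : ℤ, a = a' + t ∧ b = b' + t ∧ a + b ≤ 0 ∧
      -1 ≤ a + b := ⟨-((a' + b' + 1) / 2), _, _, rfl, rfl, by omega, by omega⟩
  obtain ⟨x, hx0, hx⟩ := hc k a b hk (by omega) hab
  set δ := diagonal ![varT Fq ^ a, varT Fq ^ b] with hδ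
  have hδd : Valued.v δ.det = exp (a + b) := by
    rw [hδ, det_diagonal, Fin.prod_univ_two, map_mul, exp_add]; simp [-map_zpow₀]
  have hxd0 : (embed φ (x : D)).det ≠ 0 := det_embed_ne_zero φ (by simpa using hx0)
  set h' := varT Fq ^ (-c : ℤ) • (embed φ (x : D) * (k * δ)) with hh'
  have hh'd : Valued.v h'.det = exp (a + b - 2 * c) * Valued.v (embed φ (x : D)).det := by
    rw [hh', det_smul, det_mul, det_mul, map_mul, map_mul, map_mul, hkd, one_mul, hδd, map_pow,
      val_varT_zpow, ← WithZero.exp_nsmul, Fintype.card_fin, mul_left_comm, mul_comm, ← exp_add,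
      nsmul_eq_mul]
    congr 2
    push_cast
    ring
  have hxd : Valued.v (embed φ (x : D)).det ≤ exp (2 * c + 1 : ℤ) := by
    have h1 := hx.det_le
    rw [hh'd] at h1
    obtain ⟨n, hn⟩ := exists_val_eq_exp hxd0
    rw [hn, ← exp_add, ← WithZero.exp_zero, exp_le_exp] at h1
    rw [hn, exp_le_exp]
    omega
  obtain ⟨s, hs, u, hsu⟩ := hS' x (norm_ne_zero φ hΛ hx0) (by
    rw [← val_polyHom_lt_iff, polyHom_norm φ hΛ, map_pow]
    refine (pow_le_pow_left' hxd 2).trans_lt ?_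
    rw [← WithZero.exp_nsmul, exp_lt_exp]
    push_cast [nsmul_eq_mul]
    omega)
  have hs0 : s ≠ 0 := fun h => hS0 (h ▸ hs)
  have hsd := det_embed_ne_zero φ (d := (s : D)) (by simpa using hs0)
  refine ⟨unitsHom φ Λ u, ⟨u, rfl⟩, ?_⟩
  rw [Set.mem_iUnion₂]
  let y : (Kinf Fq)ˣ := Units.mk0 (varT Fq ^ (t - c)) (zpow_ne_zero _ varT_ne_zero)
  refine ⟨s, hs, scaleLattice y (unitsHom φ Λ u • L), mk_scaleLattice _ _, matLattice h',
    ⟨?_, ?_⟩, ?_⟩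
  · refine fun z hz => smul_mem_matLattice hx ?_ ?_ hz
    · rw [← Valuation.ne_zero_iff Valued.v, hh'd]
      exact mul_ne_zero exp_ne_zero ((Valuation.ne_zero_iff _).2 hxd0)
    · have : Valued.v ((uniformizer Fq ^ (2 * c + 1) : Oinf Fq) : Kinf Fq) =
          exp (-(2 * c + 1) : ℤ) := by
        rw [SubmonoidClass.coe_pow, uniformizer, inv_pow, map_inv₀, map_pow, val_varT,
          ← WithZero.exp_nsmul, WithZero.exp_neg]
        simp
      rw [this, hh'd]
      refine le_trans ?_ (le_mul_of_one_le_right' (one_le_val_det_embed φ hΛ hx0))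
      rw [exp_le_exp]
      omega
  · have := matLattice_mul_le (h := 1) hx
    rwa [one_mul] at this
  · have hδ' : δ = varT Fq ^ t • diagonal ![varT Fq ^ a', varT Fq ^ b'] := by
      rw [hδ, ha, hb, ← diagonal_smul]
      congr 1
      ext i
      fin_cases i <;> simp [zpow_add₀ varT_ne_zero, mul_comm]
    have hu : (unitsHom φ Λ u • L).1 =
        matLattice (embed φ (u : Λ) * (k * diagonal ![varT Fq ^ a', varT Fq ^ b'])) := by
      rw [BruhatTits.coe_smul, hL, hh]
      exact map_matLattice _ _
    change _ = y • (unitsHom φ Λ u • L).1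
    rw [hu, smul_matLattice]
    refine (map_matLattice _ _).trans ?_
    rw [hh', hδ', hsu, MulMemClass.coe_mul, map_mul, mul_smul_comm, mul_smul_comm, mul_smul_comm,
      mul_smul_comm, smul_smul, mul_assoc, nonsing_inv_mul_cancel_left _ _ hsd.isUnit,
      ← zpow_add₀ varT_ne_zero, Units.val_mk0, neg_add_eq_sub]

/-- The group of units of an order preserves the type of a vertex, so it has no inversions. -/
theorem actsWithoutInversion_unitGroup [Module.Finite (RatFunc Fq) D]
    (hΛ : IsOrder (RatFunc Fq) Λ) :
    SerreGraph.ActsWithoutInversion (unitGroup φ Λ) (treeInf Fq) := by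
  rintro ⟨_, u, rfl⟩ y hy
  exact smul_ne_of_near (g := unitsHom φ Λ u) rfl (val_det_embed_unit φ hΛ u) y.adj.ne
    (Near.of_adj y.adj) (congrArg (treeInf Fq).o hy)

end Minkowski

end QuaternionTree

theorem proposition3p1 {Fq : Type*} [Field Fq] [Finite Fq] [DecidableEq (RatFunc Fq)]
    {D : Type*} [DivisionRing D] [Algebra (RatFunc Fq) D]
    [Algebra.IsCentral (RatFunc Fq) D] (hD : Module.finrank (RatFunc Fq) D = 4)
    [Algebra Fq[X] D] [IsScalarTower Fq[X] (RatFunc Fq) D]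
    (φ : TensorProduct (RatFunc Fq) (RatFunc.CompletionAtInfty Fq) D
      ≃ₐ[RatFunc.CompletionAtInfty Fq] Matrix (Fin 2) (Fin 2) (RatFunc.CompletionAtInfty Fq))
    (Λ : Subalgebra Fq[X] D) (hΛ : IsMaximalOrder (RatFunc Fq) Λ) :
    ∃ h : SerreGraph.ActsWithoutInversion (QuaternionTree.unitGroup φ Λ)
        (QuaternionTree.treeInf Fq),
      (SerreGraph.quotient (QuaternionTree.unitGroup φ Λ)
        (QuaternionTree.treeInf Fq) h).IsFinite := by
  have : Module.Finite (RatFunc Fq) D := Module.finite_of_finrank_eq_succ hD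
  have hΛ' : IsOrder (RatFunc Fq) Λ := hΛ.prop
  refine ⟨QuaternionTree.actsWithoutInversion_unitGroup φ hΛ', ?_, ?_⟩
  all_goals obtain ⟨R, hR, hRv⟩ := QuaternionTree.exists_finite_vertices φ hΛ' hD
  · refine (hR.image (Quotient.mk (MulAction.orbitRel (QuaternionTree.unitGroup φ Λ)
      (QuaternionTree.treeInf Fq).Ver))).subset ?_ |> Set.finite_univ_iff.1
    rintro ⟨v⟩ -
    obtain ⟨g, hg, hgv⟩ := hRv v
    exact ⟨g • v, hgv, Quotient.sound ⟨⟨g, hg⟩, rfl⟩⟩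
  · refine ((QuaternionTree.finite_darts_of_fst_mem hR).image
      (Quotient.mk (MulAction.orbitRel (QuaternionTree.unitGroup φ Λ)
      (QuaternionTree.treeInf Fq).Ed))).subset ?_ |> Set.finite_univ_iff.1
    rintro ⟨y⟩ -
    obtain ⟨g, hg, hgv⟩ := hRv ((QuaternionTree.treeInf Fq).o y)
    exact ⟨(⟨g, hg⟩ : QuaternionTree.unitGroup φ Λ) • y, hgv, Quotient.sound ⟨⟨g, hg⟩, rfl⟩⟩
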